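/- For a locally compact Hausdorff group $G$, let $\Delta_G : G \to (0,\infty)$ denote its modular function, normalized by $$\int_G f(xg)\,dx = \Delta_G(g)^{-1}\int_G f(x)\,dx$$ for $g \in G$, $f \in C_c(G)$ and a left Haar measure $dx$ on $G$. Let $G$ be a locally compact Hausdorff group, let $N \subseteq H \subseteq G$ be closed subgroups with $N$ normal in $G$, and let $\overline{G} = G/N$ and $\overline{H} = H/N$ be the quotient groups with the quotient topologies. Then for every $h \in H$ $$\frac{\Delta_G(h)}{\Delta_{\overline{G}}(hN)} = \frac{\Delta_H(h)}{\Delta_{\overline{H}}(hN)}.$$ In particular, if $H = N$, then $\Delta_G(h) = \Delta_H(h)$ for every $h \in H$. -/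

import Mathlib

open MeasureTheory MeasureTheory.Measure

/-- A closed subgroup of a locally compact group is locally compact. -/
instance closedSubgroup_locallyCompactSpace {G : Type*} [TopologicalSpace G] [Group G]
    [LocallyCompactSpace G] (H : Subgroup G) [hH : IsClosed (H : Set G)] :
    LocallyCompactSpace H :=
  hH.isClosedEmbedding_subtypeVal.locallyCompactSpace

/-- The modular function `Δ_G` of a locally compact group `G`, as a real-valued function, with the
normalization `∫ f (x * g) dx = Δ_G(g)⁻¹ * ∫ f x dx` for a left Haar measure `dx`
(see `integral_mul_right_eq_modularFunction`). Mathlib's `modularCharacter` satisfies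
`∫ f (x * g) dx = modularCharacter g * ∫ f x dx`, hence the inverse. -/
noncomputable def modularFunction {G : Type*} [TopologicalSpace G] [Group G]
    [IsTopologicalGroup G] [LocallyCompactSpace G] (g : G) : ℝ :=
  ((modularCharacter (g⁻¹) : NNReal) : ℝ)

theorem modularFunction_pos {G : Type*} [TopologicalSpace G] [Group G]
    [IsTopologicalGroup G] [LocallyCompactSpace G] (g : G) : 0 < modularFunction g :=
  NNReal.coe_pos.mpr (modularCharacterFun_pos g⁻¹)

/-- The defining property of the modular function, for every left Haar measure. -/
theorem integral_mul_right_eq_modularFunction {G : Type*} [TopologicalSpace G] [Group G]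
    [IsTopologicalGroup G] [LocallyCompactSpace G] [MeasurableSpace G] [BorelSpace G]
    (μ : Measure G) [IsHaarMeasure μ] (g : G) {f : G → ℝ} (hf : Continuous f)
    (hc : HasCompactSupport f) :
    ∫ x, f (x * g) ∂μ = (modularFunction g)⁻¹ * ∫ x, f x ∂μ := by
  have h1 : (modularFunction g)⁻¹ = ((modularCharacterFun g : NNReal) : ℝ) := by
    have h2 : modularCharacterFun g * modularCharacterFun g⁻¹ = 1 := by
      rw [← modularCharacterFun_map_mul, mul_inv_cancel, modularCharacterFun_map_one]
    have h3 : ((modularCharacterFun g : NNReal) : ℝ) * (modularCharacterFun g⁻¹ : NNReal) = 1 := by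
      exact_mod_cast h2
    exact (eq_inv_of_mul_eq_one_left h3).symm
  have h4 := integral_isMulLeftInvariant_eq_smul_of_hasCompactSupport (map (· * g) μ) μ hf hc
  have h5 : ∫ y, f y ∂(map (· * g) μ) = ∫ x, f (x * g) ∂μ :=
    (Homeomorph.mulRight g).measurableEmbedding.integral_map f
  rw [h5] at h4
  rw [h1, modularCharacterFun_eq_haarScalarFactor μ g, h4, integral_smul_nnreal_measure]
  rfl

/-! Both `G` and `H` are extensions with the same kernel `N`. Haar measure on an extension is Haar
measure along the kernel followed by Haar measure on the quotient, so right translation by `b`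
scales it by two factors: one from translation by the image of `b` in the quotient, one from
conjugation by `b` on the kernel (`TopologicalGroup.IsSES.modularFunction_eq`). For `h` in `H` the
second factor depends only on how `h` acts on `N`, so it is the same in `G` and in `H`. -/

theorem modularFunction_one {G : Type*} [TopologicalSpace G] [Group G]
    [IsTopologicalGroup G] [LocallyCompactSpace G] : modularFunction (1 : G) = 1 := by
  simp [modularFunction]

/-- In a short exact sequence `1 → A → B → C → 1` of locally compact groups, the modular functions
of `B` and `C` differ by the factor by which conjugation scales the Haar measure of `A`. -/
theorem TopologicalGroup.IsSES.modularFunction_eq {A B C : Type*} [Group A] [Group B] [Group C]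
    [TopologicalSpace A] [TopologicalSpace B] [TopologicalSpace C] [IsTopologicalGroup A]
    [IsTopologicalGroup B] [IsTopologicalGroup C] [LocallyCompactSpace A] [LocallyCompactSpace B]
    [LocallyCompactSpace C] [T2Space B] [MeasurableSpace A] [BorelSpace A]
    {φ : A →* B} {ψ : B →* C} (S : TopologicalGroup.IsSES φ ψ) (b : B) (α : A ≃ₜ* A)
    (hα : ∀ a, φ (α a) = b⁻¹ * φ a * b) :
    modularFunction b = mulEquivHaarChar α * modularFunction (ψ b) := by
  borelize B C
  let μA : Measure A := haar
  let μC : Measure C := haar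
  let μB : Measure B := S.inducedMeasure μA μC
  obtain ⟨f, hc, hf, hf1⟩ := exists_continuous_nonneg_pos (1 : B)
  have hpos : ∫ x, f x ∂μB ≠ 0 :=
    (f.continuous.integral_pos_of_hasCompactSupport_nonneg_nonzero hc hf hf1).ne'
  let F : CompactlySupportedContinuousMap B ℝ := ⟨f, hc⟩
  let Fb : CompactlySupportedContinuousMap B ℝ := F.comp (Homeomorph.mulRight b).toCocompactMap
  have hchar : (mulEquivHaarChar α : ℝ) ≠ 0 := (NNReal.coe_pos.mpr (mulEquivHaarChar_pos α)).ne'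
  -- On the fibre over `ψ x`, moving `b` past the kernel gives `x * φ a * b = x * b * φ (α a)`;
  -- substituting along `α` costs the inverse of its Haar character.
  have hpush (c : C) :
      S.pushforward μA Fb c = (mulEquivHaarChar α : ℝ)⁻¹ * S.pushforward μA F (c * ψ b) := by
    obtain ⟨x, rfl⟩ := S.isOpenQuotientMap.surjective c
    rw [← map_mul, S.pushforward_apply_apply, S.pushforward_apply_apply,
      ← mulEquivHaarChar_smul_integral_map μA (f := S.pullback F (x * b)) α,
      NNReal.smul_def, smul_eq_mul, inv_mul_cancel_left₀ hchar]
    refine Eq.trans ?_ (α.toHomeomorph.measurableEmbedding.integral_map _).symm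
    refine integral_congr_ae (.of_forall fun a ↦ ?_)
    change f (x * φ a * b) = f (x * b * φ (α a))
    rw [hα]
    simp only [mul_assoc, mul_inv_cancel_left]
  have hB : ∫ x, f (x * b) ∂μB =
      (mulEquivHaarChar α : ℝ)⁻¹ * ((modularFunction (ψ b))⁻¹ * ∫ x, f x ∂μB) := by
    calc ∫ x, f (x * b) ∂μB = S.integrate μA μC Fb := S.integral_inducedMeasure μA μC Fb
      _ = ∫ c, (mulEquivHaarChar α : ℝ)⁻¹ * S.pushforward μA F (c * ψ b) ∂μC :=
        integral_congr_ae (.of_forall hpush)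
      _ = (mulEquivHaarChar α : ℝ)⁻¹ *
          ((modularFunction (ψ b))⁻¹ * ∫ c, S.pushforward μA F c ∂μC) := by
        rw [integral_const_mul]
        exact congrArg _ (integral_mul_right_eq_modularFunction μC (ψ b)
          (S.pushforward μA F).continuous (S.pushforward μA F).hasCompactSupport)
      _ = _ := by
        rw [← S.integrate_apply, ← S.integral_inducedMeasure μA μC F]
        rfl
  rw [integral_mul_right_eq_modularFunction μB b f.continuous hc, ← mul_assoc] at hB
  have h := mul_right_cancel₀ hpos hB
  rwa [← mul_inv, inv_inj] at h

/-- A closed subgroup containing a closed normal subgroup is an extension of the quotient. -/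
theorem TopologicalGroup.IsSES.inclusion {G : Type*} [TopologicalSpace G] [Group G]
    [IsTopologicalGroup G] {N H : Subgroup G} [N.Normal] (hN : IsClosed (N : Set G))
    (hNH : N ≤ H) :
    TopologicalGroup.IsSES (Subgroup.inclusion hNH) (QuotientGroup.mk' (N.subgroupOf H)) where
  isClosedEmbedding := by
    refine ⟨Topology.IsEmbedding.inclusion hNH, ?_⟩
    have : Set.range (Subgroup.inclusion hNH) = Subtype.val ⁻¹' (N : Set G) := by
      ext x
      exact ⟨fun ⟨y, hy⟩ ↦ hy ▸ y.2, fun hx ↦ ⟨⟨x, hx⟩, rfl⟩⟩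
    rw [this]
    exact hN.preimage continuous_subtype_val
  isOpenQuotientMap := MulAction.isOpenQuotientMap_quotientMk
  mulExact x := by
    rw [QuotientGroup.mk'_apply, QuotientGroup.eq_one_iff, Subgroup.mem_subgroupOf]
    exact ⟨fun hx ↦ ⟨⟨x, hx⟩, rfl⟩, fun ⟨y, hy⟩ ↦ hy ▸ y.2⟩

/-- Conjugation `n ↦ g * n * g⁻¹` as a topological automorphism of a normal subgroup. -/
def ContinuousMulEquiv.conjNormal {G : Type*} [TopologicalSpace G] [Group G]
    [IsTopologicalGroup G] (N : Subgroup G) [N.Normal] (g : G) : N ≃ₜ* N where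
  toMulEquiv := MulAut.conjNormal g
  continuous_toFun := by
    refine Continuous.subtype_mk (f := fun n : N ↦ g * n * g⁻¹) (by fun_prop) _
  continuous_invFun := by
    refine Continuous.subtype_mk (f := fun n : N ↦ g⁻¹ * n * g⁻¹⁻¹) (by fun_prop) _

theorem mainTheorem1 {G : Type*} [TopologicalSpace G] [Group G] [IsTopologicalGroup G]
    [LocallyCompactSpace G] [T2Space G] (N H : Subgroup G) [N.Normal]
    [IsClosed (N : Set G)] [IsClosed (H : Set G)] (hNH : N ≤ H) :
    (∀ h : H,
      modularFunction (h : G) / modularFunction (QuotientGroup.mk (h : G) : G ⧸ N) =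
        modularFunction h / modularFunction (QuotientGroup.mk h : H ⧸ N.subgroupOf H)) ∧
    (H = N → ∀ h : H, modularFunction (h : G) = modularFunction h) := by
  have hN : IsClosed (N : Set G) := inferInstance
  have key (h : H) :
      modularFunction (h : G) / modularFunction (QuotientGroup.mk (h : G) : G ⧸ N) =
        modularFunction h / modularFunction (QuotientGroup.mk h : H ⧸ N.subgroupOf H) := by
    borelize ↥N
    -- The inverse turns `g * n * g⁻¹` into the required `h⁻¹ * n * h`. This one `α` serves both
    -- extensions.
    let α : N ≃ₜ* N := ContinuousMulEquiv.conjNormal N (h : G)⁻¹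
    have hα (a : N) : ((α a : N) : G) = (h : G)⁻¹ * a * h := by
      change (h : G)⁻¹ * a * (h : G)⁻¹⁻¹ = _
      rw [inv_inv]
    have hG := (TopologicalGroup.IsSES.ofClosedSubgroup N hN).modularFunction_eq (h : G) α hα
    have hH := (TopologicalGroup.IsSES.inclusion hN hNH).modularFunction_eq h α
      fun a ↦ Subtype.ext (hα a)
    rw [hG, hH]
    exact (mul_div_cancel_right₀ _ (modularFunction_pos _).ne').trans
      (mul_div_cancel_right₀ _ (modularFunction_pos _).ne').symm
  refine ⟨key, fun hHN h ↦ ?_⟩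
  have hhN : (h : G) ∈ N := hHN ▸ h.2
  have h1 : (QuotientGroup.mk (h : G) : G ⧸ N) = 1 := (QuotientGroup.eq_one_iff _).mpr hhN
  have h2 : (QuotientGroup.mk h : H ⧸ N.subgroupOf H) = 1 :=
    (QuotientGroup.eq_one_iff _).mpr (Subgroup.mem_subgroupOf.mpr hhN)
  simpa only [h1, h2, modularFunction_one, div_one] using key h
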